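/- Let $d, M \ge 1$ be integers, let $p \in \mathbb{R}[x_1,\dots,x_d]$ be a polynomial of total degree at most $2M$ with $p(\xi) \ge 0$ for all $\xi \in \mathbb{R}^d$, and let $t \in [0,1)$ and $\varepsilon > 0$ be real numbers. For $q = \sum_{\alpha} q_\alpha x^\alpha \in \mathbb{R}[x_1,\dots,x_d]$ put $$\|q\| := \sum_{\alpha \in \mathbb{N}_0^d} |q_\alpha|\,\sqrt{\alpha!}, \qquad \alpha! := \prod_{j=1}^d \alpha_j!,$$ and set $$\mu := M \binom{2M+d-1}{d-1}^{1/2} 2^{M+\frac12} .$$ Let $N_{\mathrm{expl}}(p/\varepsilon) \in \mathbb{N}_0$ be the maximum of $$2M + \left\lceil \frac{5d}{2} \right\rceil + 2$$ and $$\left\lceil 2\mathrm{e}\,\bigl(4\mu\,\|p/\varepsilon\|\bigr)^{\frac{1}{1-t}} \right\rceil + \max\left\{0,\ \left\lceil \frac{1}{1-t} \ln\!\left( \frac{(d+1)^2\, 2^{2d}\, \|p/\varepsilon\|}{\mu} \right) \right\rceil \right\} + \left\lfloor \frac{3d}{2} \right\rfloor + 1,$$ where $\mathrm{e}$ is Euler's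 number and, if $p = 0$, the inner maximum is read as $0$. Then $$p + \varepsilon \sum_{n=0}^{N_{\mathrm{expl}}(p/\varepsilon)} \frac{1}{(n!)^t} \Bigl( \sum_{j=1}^d x_j^2 \Bigr)^{n}$$ is a sum of squares of polynomials in $\mathbb{R}[x_1,\dots,x_d]$. -/

import Mathlib

namespace SOSPerturbation

noncomputable section

/-- The weighted coefficient norm `‖q‖ = ∑_α |q_α| (α!)^{1/2}`, with `α! = ∏_j α_j!`. -/
def coeffNorm {d : ℕ} (q : MvPolynomial (Fin d) ℝ) : ℝ :=
  ∑ α ∈ q.support, |q.coeff α| * Real.sqrt (∏ j, ((α j).factorial : ℝ))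

/-- The constant `μ = M * binom(2M+d-1, d-1)^{1/2} * 2^{M+1/2}` (for `1 ≤ d`). -/
def mu (d M : ℕ) : ℝ :=
  (M : ℝ) * Real.sqrt ((Nat.choose (2 * M + d - 1) (d - 1) : ℕ) : ℝ) *
    (2 : ℝ) ^ ((M : ℝ) + 1 / 2)

/-- The explicit truncation order of `q`. All integers below are nonnegative, so `Int.toNat` only
changes the type; for `q = 0` the value `Real.log 0 = 0` gives the same maximum as `-∞` would. -/
def Nexpl {d : ℕ} (M : ℕ) (t : ℝ) (q : MvPolynomial (Fin d) ℝ) : ℕ :=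
  (max
    (2 * (M : ℤ) + ⌈5 * (d : ℝ) / 2⌉ + 2)
    (⌈2 * Real.exp 1 * (4 * mu d M * coeffNorm q) ^ (1 / (1 - t))⌉
      + max 0
          ⌈1 / (1 - t) *
            Real.log (((d : ℝ) + 1) ^ 2 * 2 ^ (2 * d) * coeffNorm q / mu d M)⌉
      + ⌊3 * (d : ℝ) / 2⌋ + 1)).toNat

/-- The polynomial `∑_{n=0}^N (x_1^2 + ⋯ + x_d^2)^n / (n!)^t`. -/
def perturbation (d : ℕ) (t : ℝ) (N : ℕ) : MvPolynomial (Fin d) ℝ :=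
  ∑ n ∈ Finset.range (N + 1),
    MvPolynomial.C (1 / (n.factorial : ℝ) ^ t) * (∑ j : Fin d, MvPolynomial.X j ^ 2) ^ n

end

end SOSPerturbation

/-! Let `Y` be a centred Gaussian vector with independent coordinates of small variance `v`. For
`p ≥ 0` the Gram matrix `G_{βγ} = 𝔼 [p(Y) H_β(Y) H_γ(Y)]`, where the `H_β` are rescaled Hermite
polynomials, is positive semidefinite, so `∑_{|β|,|γ| ≤ N} G_{βγ} x^{β+γ}` is a sum of squares.
The scaling of the `H_β` is such that the generating function `∑_β H_β(Y) x^β` squares to the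
density of `x + Y` relative to `Y`; hence the terms with `|β + γ| ≤ N` add up to the part of degree
at most `N` of `𝔼 p(x + Y)`, and this differs from `p` by a polynomial of norm at most
`((1+v)^{deg p} - 1) ‖p‖`.

Since `∑_n |x|^{2n} / (n!)^t = ∑_β (|β|!)^{1-t} / β! x^{2β}`, the perturbation has two roles. By the
arithmetic-geometric mean inequality, `3/4` of its `t = 1` case absorbs the difference from `p` when
`v` is of order `1 / ‖p‖`. The remaining `1/4` absorbs the terms with `|β + γ| > N`, which the
growth of `(|β|!)^{1-t}` makes small as soon as `N ≥ 2e (1/v)^{1/(1-t)}`. -/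

namespace SOSPerturbation

open MvPolynomial MeasureTheory ProbabilityTheory
open Finset.HasAntidiagonal (antidiagonal mem_antidiagonal)
open scoped NNReal

noncomputable section

section SumSq

variable {A : Type*} [CommRing A] [Algebra ℝ A]

lemma isSumSq_smul {a : ℝ} (ha : 0 ≤ a) {f : A} (hf : IsSumSq f) : IsSumSq (a • f) := by
  have hsq : (algebraMap ℝ A) a = algebraMap ℝ A √a * algebraMap ℝ A √a := by
    rw [← map_mul, Real.mul_self_sqrt ha]
  rw [Algebra.smul_def, hsq]
  exact (IsSumSq.mul_self _).mul hf

lemma isSumSq_smul_sq {a : ℝ} (ha : 0 ≤ a) (f : A) : IsSumSq (a • f ^ 2) :=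
  isSumSq_smul ha (IsSquare.sq f).isSumSq

lemma isSumSq_smul_add_abs_smul (c : ℝ) (f : A) :
    IsSumSq (c • f + (|c| / 2) • (1 + f ^ 2)) := by
  rcases le_total 0 c with hc | hc
  · have hsq : c • f + (c / 2) • (1 + f ^ 2) = (c / 2) • (1 + f) ^ 2 := by
      rw [add_sq, one_pow, mul_one, two_mul]
      module
    rw [abs_of_nonneg hc, hsq]
    exact isSumSq_smul_sq (by linarith) _
  · have hsq : c • f + (-c / 2) • (1 + f ^ 2) = (-c / 2) • (1 - f) ^ 2 := by
      rw [sub_sq, one_pow, mul_one, two_mul]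
      module
    rw [abs_of_nonpos hc, hsq]
    exact isSumSq_smul_sq (by linarith) _

lemma isSumSq_sum_smul_of_posSemidef {ι : Type*} {I : Finset ι} {G : ι → ι → ℝ}
    (hsymm : ∀ i j, G i j = G j i)
    (hG : ∀ v : ι → ℝ, 0 ≤ ∑ i ∈ I, ∑ j ∈ I, v i * v j * G i j) (m : ι → A) :
    IsSumSq (∑ i ∈ I, ∑ j ∈ I, G i j • (m i * m j)) := by
  classical
  have hpsd : (Matrix.of fun i j : I => G i j).PosSemidef := by
    refine Matrix.posSemidef_iff_dotProduct_mulVec.mpr ⟨?_, fun v => ?_⟩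
    · ext i j
      simp only [Matrix.conjTranspose_apply, Matrix.of_apply, star_trivial, hsymm i j]
    · have h := hG fun i => if hi : i ∈ I then v ⟨i, hi⟩ else 0
      simp only [← Finset.sum_coe_sort I] at h
      simpa [dotProduct, Matrix.mulVec, Finset.mul_sum, mul_assoc, mul_left_comm, mul_comm] using h
  obtain ⟨k, v, hv⟩ := Matrix.posSemidef_iff_eq_sum_vecMulVec.mp hpsd
  have hGv (i j : I) : G i j = ∑ l, v l i * v l j := by
    simpa [Matrix.sum_apply, Matrix.vecMulVec_apply] using congrFun₂ hv i j
  have hsq : ∑ i ∈ I, ∑ j ∈ I, G i j • (m i * m j) = ∑ l, (∑ i : I, v l i • m i) ^ 2 := by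
    simp only [← Finset.sum_coe_sort I, hGv, sq, Finset.sum_mul_sum, Finset.sum_smul,
      smul_mul_smul_comm]
    exact (Finset.sum_congr rfl fun i _ => Finset.sum_comm).trans Finset.sum_comm
  rw [hsq]
  exact IsSumSq.sum_sq _ _

lemma abs_sum_sum_mul_mul_le {ι : Type*} {I : Finset ι} {E : ι → ι → ℝ} {w s : ι → ℝ}
    (hw : ∀ i ∈ I, 0 ≤ w i)
    (hE : ∀ i ∈ I, ∀ j ∈ I, |E i j| ≤ s i * s j * (√(w i) * √(w j))) (v : ι → ℝ) :
    |∑ i ∈ I, ∑ j ∈ I, v i * v j * E i j| ≤ (∑ i ∈ I, s i ^ 2) * ∑ i ∈ I, w i * v i ^ 2 := by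
  calc |∑ i ∈ I, ∑ j ∈ I, v i * v j * E i j|
      ≤ ∑ i ∈ I, ∑ j ∈ I, |v i * v j * E i j| :=
        (Finset.abs_sum_le_sum_abs _ _).trans
          (Finset.sum_le_sum fun i _ => Finset.abs_sum_le_sum_abs _ _)
    _ ≤ ∑ i ∈ I, ∑ j ∈ I, (s i * (√(w i) * |v i|)) * (s j * (√(w j) * |v j|)) := by
        refine Finset.sum_le_sum fun i hi => Finset.sum_le_sum fun j hj => ?_
        rw [abs_mul, abs_mul]
        calc |v i| * |v j| * |E i j|
            ≤ |v i| * |v j| * (s i * s j * (√(w i) * √(w j))) := by gcongr; exact hE i hi j hj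
          _ = _ := by ring
    _ = (∑ i ∈ I, s i * (√(w i) * |v i|)) ^ 2 := by rw [sq, Finset.sum_mul_sum]
    _ ≤ (∑ i ∈ I, s i ^ 2) * ∑ i ∈ I, (√(w i) * |v i|) ^ 2 := Finset.sum_mul_sq_le_sq_mul_sq _ _ _
    _ = _ := by
        congr 1
        refine Finset.sum_congr rfl fun i hi => ?_
        rw [mul_pow, sq_abs, Real.sq_sqrt (hw i hi)]

lemma isSumSq_sum_smul_add_sum_smul_sq {ι : Type*} {I : Finset ι} {E : ι → ι → ℝ} {w s : ι → ℝ}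
    (hsymm : ∀ i j, E i j = E j i) (hw : ∀ i ∈ I, 0 ≤ w i)
    (hE : ∀ i ∈ I, ∀ j ∈ I, |E i j| ≤ s i * s j * (√(w i) * √(w j)))
    (m : ι → A) :
    IsSumSq (∑ i ∈ I, ∑ j ∈ I, E i j • (m i * m j) +
      (∑ i ∈ I, s i ^ 2) • ∑ i ∈ I, w i • m i ^ 2) := by
  classical
  set S := ∑ i ∈ I, s i ^ 2
  have hdiag : ∑ i ∈ I, ∑ j ∈ I, E i j • (m i * m j) + S • ∑ i ∈ I, w i • m i ^ 2 =
      ∑ i ∈ I, ∑ j ∈ I, (E i j + if i = j then S * w i else 0) • (m i * m j) := by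
    simp only [add_smul, Finset.sum_add_distrib, ite_smul, zero_smul, Finset.sum_ite_eq,
      Finset.smul_sum, smul_smul, sq]
    congr 1
    exact Finset.sum_congr rfl fun i hi => by rw [if_pos hi]
  rw [hdiag]
  refine isSumSq_sum_smul_of_posSemidef (fun i j => ?_) (fun v => ?_) m
  · rw [hsymm i j]
    congr 1
    grind
  · have habs := abs_sum_sum_mul_mul_le hw hE v
    have hquad : ∑ i ∈ I, ∑ j ∈ I, v i * v j * (E i j + if i = j then S * w i else 0) =
        ∑ i ∈ I, ∑ j ∈ I, v i * v j * E i j + S * ∑ i ∈ I, w i * v i ^ 2 := by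
      simp only [mul_add, Finset.sum_add_distrib, mul_ite, mul_zero, Finset.sum_ite_eq,
        Finset.mul_sum]
      congr 1
      exact Finset.sum_congr rfl fun i hi => by rw [if_pos hi]; ring
    rw [hquad]
    linarith [neg_abs_le (∑ i ∈ I, ∑ j ∈ I, v i * v j * E i j)]

end SumSq

section MultiIndex

variable {σ : Type*} [Fintype σ]

/-- The multi-index factorial `α! = ∏_j α_j!`, as a real number. -/
def multiFactorial (α : σ →₀ ℕ) : ℝ := ∏ j, ((α j).factorial : ℝ)

lemma multiFactorial_pos (α : σ →₀ ℕ) : 0 < multiFactorial α :=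
  Finset.prod_pos fun _ _ => by positivity

lemma multiFactorial_zero : multiFactorial (0 : σ →₀ ℕ) = 1 := by simp [multiFactorial]

lemma sqrt_multiFactorial (α : σ →₀ ℕ) :
    √(multiFactorial α) = ∏ j, √((α j).factorial : ℝ) :=
  Real.sqrt_prod _ fun _ _ => by positivity

/-- The finite set of multi-indices of length `|α| = ∑_j α_j` at most `N`. -/
def multiIndices (σ : Type*) [Fintype σ] (N : ℕ) : Finset (σ →₀ ℕ) :=
  (Finsupp.finite_of_degree_le N).toFinset

@[simp]
lemma mem_multiIndices {N : ℕ} {α : σ →₀ ℕ} : α ∈ multiIndices σ N ↔ α.degree ≤ N := by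
  simp [multiIndices]

lemma sum_multiIndices_prod_le (N : ℕ) {f : σ → ℕ → ℝ} (hf : ∀ j n, 0 ≤ f j n) :
    ∑ α ∈ multiIndices σ N, ∏ j, f j (α j) ≤ ∏ j, ∑ n ∈ Finset.range (N + 1), f j n := by
  classical
  rw [Finset.prod_univ_sum]
  refine (Finset.sum_map (multiIndices σ N) Finsupp.equivFunOnFinite.toEmbedding
    fun α => ∏ j, f j (α j)).symm.trans_le ?_
  refine Finset.sum_le_sum_of_subset_of_nonneg ?_ fun α _ _ => Finset.prod_nonneg fun j _ => hf j _
  intro α hα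
  obtain ⟨β, hβ, rfl⟩ := Finset.mem_map.mp hα
  exact Fintype.mem_piFinset.mpr fun j => Finset.mem_range_succ_iff.mpr
    ((Finsupp.le_degree j β).trans (mem_multiIndices.mp hβ))

lemma sum_antidiagonal_prod [DecidableEq σ] {R : Type*} [CommSemiring R] (f g : σ → ℕ → R)
    (δ : σ →₀ ℕ) :
    ∑ p ∈ antidiagonal δ, (∏ j, f j (p.1 j)) * ∏ j, g j (p.2 j) =
      ∏ j, ∑ q ∈ antidiagonal (δ j), f j q.1 * g j q.2 := by
  rw [Finset.prod_univ_sum]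
  refine Finset.sum_bij' (fun p _ j => (p.1 j, p.2 j))
    (fun q _ => (Finsupp.equivFunOnFinite.symm fun j => (q j).1,
      Finsupp.equivFunOnFinite.symm fun j => (q j).2)) ?_ ?_ ?_ ?_ ?_
  · intro p hp
    exact Fintype.mem_piFinset.mpr fun j => by
      rw [← mem_antidiagonal.mp hp]
      simp
  · intro q hq
    rw [mem_antidiagonal]
    ext j
    simpa using Fintype.mem_piFinset.mp hq j
  · intro p _
    ext <;> rfl
  · intro q _
    rfl
  · intro p _
    exact Finset.prod_mul_distrib.symm

lemma sum_pow_eq_sum_multiIndices {R : Type*} [CommSemiring R] (f : σ → R) {n N : ℕ} (h : n ≤ N) :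
    (∑ j, f j) ^ n = ∑ α ∈ multiIndices σ N with α.degree = n,
      (Nat.multinomial Finset.univ α : R) * ∏ j, f j ^ α j := by
  classical
  rw [Finset.sum_pow_eq_sum_piAntidiag]
  refine (Finset.sum_equiv Finsupp.equivFunOnFinite (fun α => ?_) fun _ _ => rfl).symm
  simp only [Finset.mem_filter, mem_multiIndices, Finsupp.degree_eq_sum, Finset.mem_piAntidiag,
    Finset.mem_univ, implies_true, and_true, Finsupp.equivFunOnFinite_apply]
  omega

end MultiIndex

section Perturbation

variable {d : ℕ}

/-- The coefficient `(|β|!)^{1-t} / β!` of `x^{2β}` in `∑_n |x|^{2n} / (n!)^t`. -/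
def weight (t : ℝ) (β : Fin d →₀ ℕ) : ℝ := (β.degree.factorial : ℝ) ^ (1 - t) / multiFactorial β

lemma weight_pos (t : ℝ) (β : Fin d →₀ ℕ) : 0 < weight t β :=
  div_pos (Real.rpow_pos_of_pos (by positivity) _) (multiFactorial_pos β)

lemma perturbation_eq_sum_weight (t : ℝ) (N : ℕ) :
    perturbation d t N = ∑ β ∈ multiIndices (Fin d) N, weight t β • monomial β (1 : ℝ) ^ 2 := by
  have hdeg : ∀ β ∈ multiIndices (Fin d) N, β.degree ∈ Finset.range (N + 1) := fun β hβ =>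
    Finset.mem_range_succ_iff.mpr (mem_multiIndices.mp hβ)
  rw [perturbation, ← Finset.sum_fiberwise_of_maps_to hdeg]
  refine Finset.sum_congr rfl fun n hn => ?_
  rw [sum_pow_eq_sum_multiIndices _ (Finset.mem_range_succ_iff.mp hn), Finset.mul_sum]
  refine Finset.sum_congr rfl fun β hβ => ?_
  obtain rfl := (Finset.mem_filter.mp hβ).2
  have hmultinomial : multiFactorial β * Nat.multinomial Finset.univ β = β.degree.factorial := by
    rw [multiFactorial, Finsupp.degree_eq_sum]
    exact_mod_cast Nat.multinomial_spec Finset.univ β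
  have hweight : weight t β =
      1 / (β.degree.factorial : ℝ) ^ t * Nat.multinomial Finset.univ β := by
    have hfact : (0 : ℝ) < β.degree.factorial := by positivity
    have hpos := multiFactorial_pos β
    rw [weight, Real.rpow_sub hfact, Real.rpow_one, ← hmultinomial]
    field_simp
  have hmonomial : ∏ j, (X j ^ 2 : MvPolynomial (Fin d) ℝ) ^ β j = monomial β 1 ^ 2 := by
    rw [monomial_eq, C_1, one_mul, Finsupp.prod_fintype _ _ fun _ => pow_zero _, ← Finset.prod_pow]
    exact Finset.prod_congr rfl fun j _ => pow_right_comm _ _ _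
  rw [hmonomial, hweight, smul_eq_C_mul, C_mul, map_natCast, mul_assoc]

lemma isSumSq_perturbation (t : ℝ) (N : ℕ) : IsSumSq (perturbation d t N) := by
  rw [perturbation_eq_sum_weight]
  exact IsSumSq.sum fun β _ => isSumSq_smul_sq (weight_pos t β).le _

lemma isSumSq_perturbation_sub {s t : ℝ} (hst : t ≤ s) (N : ℕ) :
    IsSumSq (perturbation d t N - perturbation d s N) := by
  have hterm : perturbation d t N - perturbation d s N =
      ∑ n ∈ Finset.range (N + 1), (1 / (n.factorial : ℝ) ^ t - 1 / (n.factorial : ℝ) ^ s) •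
        (∑ j : Fin d, X j ^ 2) ^ n := by
    simp only [perturbation, ← Finset.sum_sub_distrib, ← C_mul', C_sub, sub_mul]
  rw [hterm]
  refine IsSumSq.sum fun n _ => isSumSq_smul (sub_nonneg.mpr ?_) ?_
  · have hone : (1 : ℝ) ≤ n.factorial := by exact_mod_cast n.factorial_pos
    gcongr
  · exact Subsemiring.mem_sumSq.mp (pow_mem (Subsemiring.mem_sumSq.mpr (IsSumSq.sum_sq _ _)) n)

lemma coeffNorm_eq_sum {q : MvPolynomial (Fin d) ℝ} {S : Finset (Fin d →₀ ℕ)}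
    (hS : q.support ⊆ S) : coeffNorm q = ∑ α ∈ S, |q.coeff α| * √(multiFactorial α) :=
  Finset.sum_subset hS fun α _ hα => by rw [notMem_support_iff.mp hα, abs_zero, zero_mul]

lemma coeffNorm_nonneg (q : MvPolynomial (Fin d) ℝ) : 0 ≤ coeffNorm q :=
  Finset.sum_nonneg fun _ _ => by positivity

lemma coeffNorm_sum_smul_le {ι : Type*} (I : Finset ι) (c : ι → ℝ)
    (f : ι → MvPolynomial (Fin d) ℝ) :
    coeffNorm (∑ i ∈ I, c i • f i) ≤ ∑ i ∈ I, |c i| * coeffNorm (f i) := by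
  classical
  set S := (∑ i ∈ I, c i • f i).support ∪ I.biUnion fun i => (f i).support
  have hf : ∀ i ∈ I, coeffNorm (f i) = ∑ α ∈ S, |(f i).coeff α| * √(multiFactorial α) :=
    fun i hi => coeffNorm_eq_sum
      ((Finset.subset_biUnion_of_mem (fun i => (f i).support) hi).trans Finset.subset_union_right)
  rw [coeffNorm_eq_sum (S := S) Finset.subset_union_left,
    Finset.sum_congr rfl fun i hi => congrArg (|c i| * ·) (hf i hi)]
  simp only [Finset.mul_sum]
  rw [Finset.sum_comm]
  refine Finset.sum_le_sum fun α _ => ?_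
  simp only [← mul_assoc, ← Finset.sum_mul, coeff_sum, coeff_smul, smul_eq_mul, ← abs_mul]
  exact mul_le_mul_of_nonneg_right (Finset.abs_sum_le_sum_abs _ _) (Real.sqrt_nonneg _)

lemma weight_one (β : Fin d →₀ ℕ) : weight 1 β = (multiFactorial β)⁻¹ := by
  rw [weight, sub_self, Real.rpow_zero, one_div]

lemma isSumSq_perturbation_one_sub {N : ℕ} {δ : Fin d →₀ ℕ} (hδ : δ.degree ≤ N) :
    IsSumSq (perturbation d 1 N - (multiFactorial δ)⁻¹ • monomial δ (1 : ℝ) ^ 2) := by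
  classical
  rw [perturbation_eq_sum_weight, ← weight_one,
    ← Finset.sum_erase_eq_sub (mem_multiIndices.mpr hδ)]
  exact IsSumSq.sum fun β _ => isSumSq_smul_sq (weight_pos _ _).le _

lemma isSumSq_monomial_add_smul_perturbation_one {N : ℕ} {δ : Fin d →₀ ℕ} (hδ : δ.degree ≤ N)
    (c : ℝ) :
    IsSumSq (monomial δ c + (|c| * √(multiFactorial δ)) • perturbation d 1 N) := by
  set s := √(multiFactorial δ)
  have hs : 0 < s := Real.sqrt_pos.mpr (multiFactorial_pos δ)
  have hss : s ^ 2 = multiFactorial δ := Real.sq_sqrt (multiFactorial_pos δ).le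
  have hcross := isSumSq_smul_add_abs_smul (c * s) (s⁻¹ • monomial δ (1 : ℝ))
  have hconst : IsSumSq (perturbation d 1 N - 1) := by
    simpa [multiFactorial_zero] using
      isSumSq_perturbation_one_sub (d := d) (N := N) (δ := 0) (by simp)
  have habsorb := isSumSq_smul (a := |c| * s / 2) (by positivity)
    (hconst.add (isSumSq_perturbation_one_sub hδ))
  have hsplit : monomial δ c + (|c| * s) • perturbation d 1 N =
      ((c * s) • s⁻¹ • monomial δ (1 : ℝ) +
        (|c * s| / 2) • (1 + (s⁻¹ • monomial δ (1 : ℝ)) ^ 2)) +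
      (|c| * s / 2) • (perturbation d 1 N - 1 +
        (perturbation d 1 N - (multiFactorial δ)⁻¹ • monomial δ (1 : ℝ) ^ 2)) := by
    rw [smul_pow, inv_pow, hss, smul_smul, mul_assoc, mul_inv_cancel₀ hs.ne', abs_mul,
      abs_of_pos hs, mul_one, smul_monomial, smul_eq_mul, mul_one]
    module
  exact hsplit ▸ hcross.add habsorb

lemma isSumSq_add_smul_perturbation_one {N : ℕ} {f : MvPolynomial (Fin d) ℝ}
    (hf : f.totalDegree ≤ N) {K : ℝ} (hK : coeffNorm f ≤ K) :
    IsSumSq (f + K • perturbation d 1 N) := by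
  have hterms : IsSumSq (f + coeffNorm f • perturbation d 1 N) := by
    rw [coeffNorm, Finset.sum_smul]
    nth_rewrite 1 [f.as_sum]
    rw [← Finset.sum_add_distrib]
    exact IsSumSq.sum fun α hα =>
      isSumSq_monomial_add_smul_perturbation_one ((le_totalDegree hα).trans hf) _
  have hrest : IsSumSq ((K - coeffNorm f) • perturbation d 1 N) :=
    isSumSq_smul (sub_nonneg.mpr hK) (isSumSq_perturbation 1 N)
  have hsplit : f + K • perturbation d 1 N =
      (f + coeffNorm f • perturbation d 1 N) + (K - coeffNorm f) • perturbation d 1 N := by module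
  exact hsplit ▸ hterms.add hrest

end Perturbation

section GaussianMean

open Polynomial (derivative)
open scoped Polynomial

variable (v : ℝ≥0)

lemma integrable_eval_gaussianReal (f : ℝ[X]) :
    Integrable (fun x => f.eval x) (gaussianReal 0 v) := by
  induction f using Polynomial.induction_on' with
  | add f g hf hg =>
    simp only [Polynomial.eval_add]
    exact hf.add hg
  | monomial n a =>
    have hpow := (memLp_id_gaussianReal (μ := 0) (v := v) n).integrable_norm_pow'
    have hmeas : AEStronglyMeasurable (fun x : ℝ => x ^ n) (gaussianReal 0 v) :=
      (continuous_pow n).aestronglyMeasurable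
    simp only [Polynomial.eval_monomial]
    exact (hpow.mono' hmeas (.of_forall fun x => by simp)).const_mul a

/-- The functional `f ↦ 𝔼 f(Y)` on polynomials, where `Y` is a centred Gaussian of variance `v`. -/
def gaussianMean : ℝ[X] →ₗ[ℝ] ℝ where
  toFun f := ∫ x, f.eval x ∂gaussianReal 0 v
  map_add' f g := by
    simp only [Polynomial.eval_add]
    exact integral_add (integrable_eval_gaussianReal v f) (integrable_eval_gaussianReal v g)
  map_smul' c f := by
    simp only [Polynomial.eval_smul]
    exact integral_smul c _

lemma gaussianMean_apply (f : ℝ[X]) : gaussianMean v f = ∫ x, f.eval x ∂gaussianReal 0 v := rfl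

lemma gaussianMean_one : gaussianMean v 1 = 1 := by simp [gaussianMean_apply]

variable {v}

lemma integrable_gaussianPDFReal_mul_eval (hv : v ≠ 0) (f : ℝ[X]) :
    Integrable fun x => gaussianPDFReal 0 v x * f.eval x := by
  have h := integrable_eval_gaussianReal v f
  rw [gaussianReal_of_var_ne_zero _ hv, integrable_withDensity_iff_integrable_smul'
    (measurable_gaussianPDF 0 v) (.of_forall fun _ => gaussianPDF_lt_top)] at h
  simpa only [toReal_gaussianPDF, smul_eq_mul] using h

lemma gaussianMean_eq_integral_volume (hv : v ≠ 0) (f : ℝ[X]) :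
    gaussianMean v f = ∫ x, gaussianPDFReal 0 v x * f.eval x := by
  simp only [gaussianMean_apply, integral_gaussianReal_eq_integral_smul hv, smul_eq_mul]

lemma hasDerivAt_gaussianPDFReal (v : ℝ≥0) (x : ℝ) :
    HasDerivAt (gaussianPDFReal 0 v) (-(x / v) * gaussianPDFReal 0 v x) x := by
  have h := ((((hasDerivAt_id x).sub_const 0).pow 2).neg.div_const (2 * v : ℝ)).exp.const_mul
    (√(2 * Real.pi * v))⁻¹
  refine h.congr_deriv ?_
  simp only [gaussianPDFReal, id, Pi.neg_apply, Pi.pow_apply, Nat.cast_ofNat, sub_zero, mul_one]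
  ring

theorem gaussianMean_X_mul (hv : v ≠ 0) (f : ℝ[X]) :
    gaussianMean v (Polynomial.X * f) = v * gaussianMean v (derivative f) := by
  have hv' : (v : ℝ) ≠ 0 := by exact_mod_cast hv
  have hderiv (x : ℝ) : HasDerivAt (fun x => gaussianPDFReal 0 v x * f.eval x)
      (gaussianPDFReal 0 v x * (derivative f - (v : ℝ)⁻¹ • (Polynomial.X * f)).eval x) x := by
    refine ((hasDerivAt_gaussianPDFReal v x).mul (f.hasDerivAt x)).congr_deriv ?_
    simp only [Polynomial.eval_sub, Polynomial.eval_smul, Polynomial.eval_mul, Polynomial.eval_X,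
      smul_eq_mul]
    ring
  have hzero := integral_eq_zero_of_hasDerivAt_of_integrable hderiv
    (integrable_gaussianPDFReal_mul_eval hv _) (integrable_gaussianPDFReal_mul_eval hv f)
  rw [← gaussianMean_eq_integral_volume hv, map_sub, map_smul, smul_eq_mul] at hzero
  field_simp at hzero
  linarith

lemma gaussianMean_X_pow_add_two (hv : v ≠ 0) (n : ℕ) :
    gaussianMean v (Polynomial.X ^ (n + 2)) =
      v * (n + 1) * gaussianMean v (Polynomial.X ^ n) := by
  rw [pow_succ', gaussianMean_X_mul hv, Polynomial.derivative_X_pow, ← Polynomial.smul_eq_C_mul,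
    map_smul, smul_eq_mul, Nat.add_sub_cancel]
  push_cast
  ring

lemma gaussianMean_X_pow_nonneg (hv : v ≠ 0) (n : ℕ) :
    0 ≤ gaussianMean v (Polynomial.X ^ n) := by
  induction n using Nat.twoStepInduction with
  | zero => simp [gaussianMean_one]
  | one => simpa using (gaussianMean_X_mul hv 1).ge
  | more n ih _ =>
    rw [gaussianMean_X_pow_add_two hv]
    positivity

end GaussianMean

section Hermite

open Polynomial (derivative)
open scoped Polynomial

/-- The coefficients of the generating function `exp(τ x z - τ z² / 2) = ∑ₙ Hₙ(x) zⁿ`: Hermite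
polynomials, rescaled to be orthogonal for the Gaussian of variance `τ⁻¹` and divided by `n!`. -/
def hermite (τ : ℝ) : ℕ → ℝ[X]
  | 0 => 1
  | n + 1 => ((n : ℝ) + 1)⁻¹ • (τ • (Polynomial.X * hermite τ n) - derivative (hermite τ n))

lemma hermite_zero (τ : ℝ) : hermite τ 0 = 1 := by rw [hermite]

lemma succ_smul_hermite_succ (τ : ℝ) (n : ℕ) :
    ((n : ℝ) + 1) • hermite τ (n + 1) =
      τ • (Polynomial.X * hermite τ n) - derivative (hermite τ n) := by
  rw [hermite, smul_inv_smul₀ (by positivity)]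

lemma derivative_hermite_succ (τ : ℝ) (n : ℕ) :
    derivative (hermite τ (n + 1)) = τ • hermite τ n := by
  induction n with
  | zero => simp [hermite]
  | succ n ih =>
    have hn : ((n + 1 : ℕ) : ℝ) + 1 ≠ 0 := by positivity
    have hderiv := congrArg derivative (succ_smul_hermite_succ τ (n + 1))
    have hrec := succ_smul_hermite_succ τ n
    simp only [Polynomial.derivative_smul, Polynomial.derivative_sub, Polynomial.derivative_mul,
      Polynomial.derivative_X, one_mul, ih, mul_smul_comm] at hderiv
    refine (smul_right_inj hn).mp (hderiv.trans ?_)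
    linear_combination (norm := (push_cast; module)) (-τ) • hrec

lemma sum_antidiagonal_hermite_mul (τ : ℝ) (n : ℕ) :
    ∑ p ∈ antidiagonal n, hermite τ p.1 * hermite τ p.2 = hermite (2 * τ) n := by
  induction n with
  | zero => simp [hermite_zero]
  | succ n ih =>
    have hsplit : ((n : ℝ) + 1) • ∑ p ∈ antidiagonal (n + 1), hermite τ p.1 * hermite τ p.2 =
        ∑ p ∈ antidiagonal (n + 1), (p.1 : ℝ) • hermite τ p.1 * hermite τ p.2 +
          ∑ p ∈ antidiagonal (n + 1), hermite τ p.1 * (p.2 : ℝ) • hermite τ p.2 := by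
      rw [Finset.smul_sum, ← Finset.sum_add_distrib]
      refine Finset.sum_congr rfl fun p hp => ?_
      have hp' : (p.1 : ℝ) + p.2 = n + 1 := by exact_mod_cast mem_antidiagonal.mp hp
      rw [← hp', add_smul, smul_mul_assoc, mul_smul_comm]
    refine (smul_right_inj (Nat.cast_add_one_ne_zero (R := ℝ) n)).mp ?_
    rw [hsplit, succ_smul_hermite_succ, ← ih, Finset.Nat.sum_antidiagonal_succ,
      Finset.Nat.sum_antidiagonal_succ']
    simp only [Nat.cast_zero, zero_smul, zero_mul, mul_zero, zero_add, Nat.cast_succ,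
      succ_smul_hermite_succ, Polynomial.derivative_sum, Polynomial.derivative_mul,
      Finset.mul_sum, Finset.smul_sum, ← Finset.sum_add_distrib, ← Finset.sum_sub_distrib]
    refine Finset.sum_congr rfl fun p _ => ?_
    simp only [Polynomial.smul_eq_C_mul, Polynomial.C_mul, Polynomial.C_ofNat]
    ring

variable {v : ℝ≥0}

theorem succ_mul_gaussianMean_mul_hermite (hv : v ≠ 0) (f : ℝ[X]) (n : ℕ) :
    (n + 1) * gaussianMean v (f * hermite (v : ℝ)⁻¹ (n + 1)) =
      gaussianMean v (derivative f * hermite (v : ℝ)⁻¹ n) := by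
  have hv' : (v : ℝ) ≠ 0 := by exact_mod_cast hv
  set H := hermite (v : ℝ)⁻¹ n
  have hstein := gaussianMean_X_mul hv (f * H)
  rw [Polynomial.derivative_mul, map_add] at hstein
  rw [← smul_eq_mul, ← map_smul, ← mul_smul_comm, succ_smul_hermite_succ, mul_sub, map_sub,
    mul_smul_comm, map_smul, mul_left_comm, hstein, smul_eq_mul, inv_mul_cancel_left₀ hv']
  ring

lemma gaussianMean_hermite_sq (hv : v ≠ 0) (n : ℕ) :
    gaussianMean v (hermite (v : ℝ)⁻¹ n ^ 2) = (v : ℝ)⁻¹ ^ n / n.factorial := by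
  induction n with
  | zero => simp [hermite_zero, gaussianMean_one]
  | succ n ih =>
    have h := succ_mul_gaussianMean_mul_hermite hv (hermite (v : ℝ)⁻¹ (n + 1)) n
    rw [derivative_hermite_succ, smul_mul_assoc, map_smul, ← sq, ← sq, ih, smul_eq_mul] at h
    refine mul_left_cancel₀ (Nat.cast_add_one_ne_zero n) (h.trans ?_)
    rw [Nat.factorial_succ, pow_succ']
    push_cast
    field_simp

/-- The coefficient of `xⁿ` in `𝔼 (x + Y)ᵃ`, where `Y` is a centred Gaussian of variance `v`. -/
def gaussianAverageCoeff (v : ℝ≥0) (a n : ℕ) : ℝ :=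
  a.choose n * gaussianMean v (Polynomial.X ^ (a - n))

lemma gaussianAverageCoeff_nonneg (hv : v ≠ 0) (a n : ℕ) : 0 ≤ gaussianAverageCoeff v a n :=
  mul_nonneg (Nat.cast_nonneg _) (gaussianMean_X_pow_nonneg hv _)

lemma gaussianAverageCoeff_self (v : ℝ≥0) (a : ℕ) : gaussianAverageCoeff v a a = 1 := by
  simp [gaussianAverageCoeff, gaussianMean_one]

lemma gaussianAverageCoeff_eq_zero (v : ℝ≥0) {a n : ℕ} (h : a < n) :
    gaussianAverageCoeff v a n = 0 := by
  simp [gaussianAverageCoeff, Nat.choose_eq_zero_of_lt h]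

theorem gaussianMean_X_pow_mul_hermite (hv : v ≠ 0) (a n : ℕ) :
    gaussianMean v (Polynomial.X ^ a * hermite (v : ℝ)⁻¹ n) = gaussianAverageCoeff v a n := by
  induction n generalizing a with
  | zero => simp [hermite_zero, gaussianAverageCoeff]
  | succ n ih =>
    have h := succ_mul_gaussianMean_mul_hermite hv (Polynomial.X ^ a) n
    refine mul_left_cancel₀ (Nat.cast_add_one_ne_zero n) (h.trans ?_)
    cases a with
    | zero => simp [gaussianAverageCoeff_eq_zero]
    | succ a =>
      have hchoose : (a + 1 : ℝ) * a.choose n = (a + 1).choose (n + 1) * (n + 1) := by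
        exact_mod_cast Nat.add_one_mul_choose_eq a n
      rw [Polynomial.derivative_X_pow, mul_assoc, ← Polynomial.smul_eq_C_mul, map_smul,
        Nat.add_sub_cancel, ih, gaussianAverageCoeff, gaussianAverageCoeff, smul_eq_mul,
        Nat.add_sub_add_right]
      push_cast
      linear_combination gaussianMean v (Polynomial.X ^ (a - n)) * hchoose

lemma gaussianAverageCoeff_add_two_zero (hv : v ≠ 0) (a : ℕ) :
    gaussianAverageCoeff v (a + 2) 0 = v * (a + 1) * gaussianAverageCoeff v a 0 := by
  simp [gaussianAverageCoeff, gaussianMean_X_pow_add_two hv]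

lemma gaussianAverageCoeff_add_two_succ (hv : v ≠ 0) (a n : ℕ) :
    gaussianAverageCoeff v (a + 2) (n + 1) =
      v * (a + 1) * gaussianAverageCoeff v a (n + 1) + gaussianAverageCoeff v (a + 1) n := by
  have hv' : (v : ℝ) ≠ 0 := by exact_mod_cast hv
  simp only [← gaussianMean_X_pow_mul_hermite hv]
  rw [pow_succ', mul_assoc, gaussianMean_X_mul hv, Polynomial.derivative_mul,
    derivative_hermite_succ, Polynomial.derivative_X_pow, mul_assoc, ← Polynomial.smul_eq_C_mul,
    mul_smul_comm, map_add, map_smul, map_smul, mul_add, smul_eq_mul, smul_eq_mul,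
    mul_inv_cancel_left₀ hv', Nat.add_sub_cancel, ← mul_assoc]
  push_cast
  ring

lemma gaussianAverageCoeff_mul_sqrt_factorial_succ_le (hv : v ≠ 0) (a n : ℕ) :
    gaussianAverageCoeff v a n * √((n + 1).factorial : ℝ) ≤
      √(a + 1 : ℝ) * (gaussianAverageCoeff v a n * √(n.factorial : ℝ)) := by
  rcases lt_or_ge a n with h | h
  · simp [gaussianAverageCoeff_eq_zero v h]
  · have hK := gaussianAverageCoeff_nonneg hv a n
    have hna : (n : ℝ) ≤ a := by exact_mod_cast h
    calc gaussianAverageCoeff v a n * √((n + 1).factorial : ℝ)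
        = √(n + 1 : ℝ) * (gaussianAverageCoeff v a n * √(n.factorial : ℝ)) := by
          rw [Nat.factorial_succ, Nat.cast_mul, Real.sqrt_mul (by positivity), Nat.cast_succ]
          ring
      _ ≤ _ := by gcongr

lemma sum_gaussianAverageCoeff_add_two_le (hv : v ≠ 0) (a N : ℕ) :
    ∑ n ∈ Finset.range (N + 1), gaussianAverageCoeff v (a + 2) n * √(n.factorial : ℝ) ≤
      v * (a + 1) * ∑ n ∈ Finset.range (N + 1), gaussianAverageCoeff v a n * √(n.factorial : ℝ) +
        √(a + 2 : ℝ) *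
          ∑ n ∈ Finset.range N, gaussianAverageCoeff v (a + 1) n * √(n.factorial : ℝ) := by
  have hshift := Finset.sum_le_sum (s := Finset.range N) fun n _ =>
    gaussianAverageCoeff_mul_sqrt_factorial_succ_le hv (a + 1) n
  rw [← Finset.mul_sum, Nat.cast_add_one, add_assoc, one_add_one_eq_two] at hshift
  refine le_trans (le_of_eq ?_) (add_le_add_right hshift _)
  rw [Finset.sum_range_succ', Finset.sum_range_succ' _ N, gaussianAverageCoeff_add_two_zero hv]
  simp only [gaussianAverageCoeff_add_two_succ hv, add_mul, Finset.sum_add_distrib, mul_add,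
    Finset.mul_sum, mul_assoc]
  ring

lemma sum_gaussianAverageCoeff_zero_le (v : ℝ≥0) (N : ℕ) :
    ∑ n ∈ Finset.range N, gaussianAverageCoeff v 0 n * √(n.factorial : ℝ) ≤ 1 := by
  rcases N with _ | N
  · simp
  · simp [Finset.sum_range_succ', gaussianAverageCoeff_eq_zero, gaussianAverageCoeff_self]

lemma sum_gaussianAverageCoeff_one_le (hv : v ≠ 0) (N : ℕ) :
    ∑ n ∈ Finset.range N, gaussianAverageCoeff v 1 n * √(n.factorial : ℝ) ≤ 1 := by
  have hzero : gaussianAverageCoeff v 1 0 = 0 := by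
    simpa [gaussianAverageCoeff] using gaussianMean_X_mul hv 1
  rcases N with _ | _ | N
  · simp
  · simp [hzero]
  · simp [Finset.sum_range_succ', gaussianAverageCoeff_eq_zero, gaussianAverageCoeff_self, hzero]

lemma add_one_mul_sqrt_factorial_le (a : ℕ) :
    (a + 1) * √(a.factorial : ℝ) ≤ √((a + 2).factorial : ℝ) := by
  refine Real.le_sqrt_of_sq_le ?_
  rw [mul_pow, Real.sq_sqrt (by positivity), Nat.factorial_succ, Nat.factorial_succ]
  push_cast
  nlinarith [Nat.cast_nonneg (α := ℝ) a, Nat.cast_nonneg (α := ℝ) a.factorial]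

lemma sum_gaussianAverageCoeff_le (hv : v ≠ 0) (a N : ℕ) :
    ∑ n ∈ Finset.range N, gaussianAverageCoeff v a n * √(n.factorial : ℝ) ≤
      (1 + v) ^ a * √(a.factorial : ℝ) := by
  induction a using Nat.twoStepInduction generalizing N with
  | zero => simpa using sum_gaussianAverageCoeff_zero_le v N
  | one =>
    refine (sum_gaussianAverageCoeff_one_le hv N).trans ?_
    simp
  | more a ih₀ ih₁ =>
    rcases N with _ | N
    · simp only [Finset.range_zero, Finset.sum_empty]
      positivity
    have hroot : √((a + 2).factorial : ℝ) = √(a + 2 : ℝ) * √((a + 1).factorial : ℝ) := by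
      rw [Nat.factorial_succ, Nat.cast_mul, Real.sqrt_mul (by positivity)]
      push_cast
      ring_nf
    calc _ ≤ _ := sum_gaussianAverageCoeff_add_two_le hv a N
      _ ≤ v * (a + 1) * ((1 + v) ^ a * √(a.factorial : ℝ)) +
          √(a + 2 : ℝ) * ((1 + v) ^ (a + 1) * √((a + 1).factorial : ℝ)) := by
        gcongr
        exacts [ih₀ _, ih₁ _]
      _ = (1 + v) ^ a * (v * ((a + 1) * √(a.factorial : ℝ)) +
          (1 + v) * √((a + 2).factorial : ℝ)) := by
        rw [hroot]
        ring
      _ ≤ (1 + v) ^ a * (v * √((a + 2).factorial : ℝ) + (1 + v) * √((a + 2).factorial : ℝ)) := by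
        gcongr
        exact add_one_mul_sqrt_factorial_le a
      _ ≤ (1 + v) ^ (a + 2) * √((a + 2).factorial : ℝ) := by
        rw [pow_add, mul_assoc, ← add_mul]
        gcongr
        nlinarith [v.coe_nonneg]

end Hermite

section MomentBound

open scoped Polynomial

variable {v : ℝ≥0}

lemma abs_pow_le_sqrt_factorial_mul_exp (x : ℝ) (a : ℕ) :
    |x| ^ a ≤ √(a.factorial : ℝ) * Real.exp (x ^ 2 / 2) := by
  have h := Real.pow_div_factorial_le_exp _ (sq_nonneg x) a
  rw [div_le_iff₀ (by positivity)] at h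
  refine (abs_le_of_sq_le_sq' ?_ (by positivity)).2
  calc (|x| ^ a) ^ 2 = (x ^ 2) ^ a := by rw [pow_right_comm, sq_abs]
    _ ≤ _ := h
    _ = (√(a.factorial : ℝ) * Real.exp (x ^ 2 / 2)) ^ 2 := by
      rw [mul_pow, Real.sq_sqrt (by positivity), ← Real.exp_nat_mul, mul_comm, Nat.cast_ofNat,
        mul_div_cancel₀ _ two_ne_zero]

lemma abs_pow_mul_gaussianPDFReal_le (hv : v ≠ 0) (hv2 : v ≤ 1 / 2) (a : ℕ) (x : ℝ) :
    |x| ^ a * gaussianPDFReal 0 v x ≤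
      √2 * √(a.factorial : ℝ) * gaussianPDFReal 0 (2 * v) x := by
  have hv2' : (v : ℝ) ≤ 1 / 2 := by exact_mod_cast hv2
  have hexp : x ^ 2 / 2 + -(x ^ 2 / (2 * v)) ≤ -(x ^ 2 / (2 * (2 * v))) := by
    have hslope : 1 / 2 ≤ 1 / (2 * (2 * (v : ℝ))) := by
      rw [div_le_div_iff₀ two_pos (by positivity)]
      linarith [hv2']
    have := mul_le_mul_of_nonneg_left hslope (sq_nonneg x)
    have hhalf : x ^ 2 / (2 * v) = x ^ 2 * (1 / (2 * (2 * v))) * 2 := by field_simp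
    rw [hhalf]
    linarith [mul_one_div (x ^ 2) (2 * (2 * (v : ℝ))), mul_one_div (x ^ 2) 2]
  have hnorm : √(2 * Real.pi * (2 * v)) = √2 * √(2 * Real.pi * v) := by
    rw [← Real.sqrt_mul two_pos.le]
    ring_nf
  simp only [gaussianPDFReal, sub_zero, neg_div, NNReal.coe_mul, NNReal.coe_ofNat, hnorm]
  calc |x| ^ a * ((√(2 * Real.pi * v))⁻¹ * Real.exp (-(x ^ 2 / (2 * v))))
      ≤ √(a.factorial : ℝ) * Real.exp (x ^ 2 / 2) *
          ((√(2 * Real.pi * v))⁻¹ * Real.exp (-(x ^ 2 / (2 * v)))) := by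
        gcongr
        exact abs_pow_le_sqrt_factorial_mul_exp x a
    _ = √(a.factorial : ℝ) * (√(2 * Real.pi * v))⁻¹ *
          Real.exp (x ^ 2 / 2 + -(x ^ 2 / (2 * v))) := by
        rw [Real.exp_add]
        ring
    _ ≤ √(a.factorial : ℝ) * (√(2 * Real.pi * v))⁻¹ * Real.exp (-(x ^ 2 / (2 * (2 * v)))) := by
        gcongr
    _ = _ := by field_simp

lemma integral_abs_eval_mul_le_sqrt (v : ℝ≥0) (f g : ℝ[X]) :
    ∫ x, |(f * g).eval x| ∂gaussianReal 0 v ≤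
      √(gaussianMean v (f ^ 2)) * √(gaussianMean v (g ^ 2)) := by
  have hmemLp (h : ℝ[X]) : MemLp (fun x => h.eval x) (ENNReal.ofReal 2) (gaussianReal 0 v) := by
    rw [ENNReal.ofReal_ofNat, memLp_two_iff_integrable_sq h.continuous.aestronglyMeasurable]
    exact (integrable_eval_gaussianReal v (h ^ 2)).congr
      (.of_forall fun x => Polynomial.eval_pow 2)
  have hholder := integral_mul_norm_le_Lp_mul_Lq Real.HolderConjugate.two_two (hmemLp f) (hmemLp g)
  simpa only [Real.norm_eq_abs, ← abs_mul, Real.rpow_two, sq_abs, ← Real.sqrt_eq_rpow,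
    ← Polynomial.eval_mul, ← Polynomial.eval_pow, ← gaussianMean_apply] using hholder

theorem abs_gaussianMean_X_pow_mul_mul_le (hv : v ≠ 0) (hv2 : v ≤ 1 / 2) (a : ℕ) (f g : ℝ[X]) :
    |gaussianMean v (Polynomial.X ^ a * (f * g))| ≤ √2 * √(a.factorial : ℝ) *
      (√(gaussianMean (2 * v) (f ^ 2)) * √(gaussianMean (2 * v) (g ^ 2))) := by
  have h2v : 2 * v ≠ 0 := mul_ne_zero two_ne_zero hv
  have hint : Integrable fun x => gaussianPDFReal 0 (2 * v) x * |(f * g).eval x| := by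
    simpa only [norm_mul, Real.norm_eq_abs, abs_of_nonneg (gaussianPDFReal_nonneg _ _ _)]
      using (integrable_gaussianPDFReal_mul_eval h2v (f * g)).norm
  have hcs := integral_abs_eval_mul_le_sqrt (2 * v) f g
  simp only [integral_gaussianReal_eq_integral_smul h2v, smul_eq_mul] at hcs
  rw [gaussianMean_eq_integral_volume hv, ← Real.norm_eq_abs]
  calc _ ≤ ∫ x, √2 * √(a.factorial : ℝ) *
        (gaussianPDFReal 0 (2 * v) x * |(f * g).eval x|) := by
        refine norm_integral_le_of_norm_le (hint.const_mul _) (.of_forall fun x => ?_)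
        rw [Real.norm_eq_abs, Polynomial.eval_mul, Polynomial.eval_pow, Polynomial.eval_X, abs_mul,
          abs_mul, abs_pow, abs_of_nonneg (gaussianPDFReal_nonneg _ _ _), ← mul_assoc, ← mul_assoc,
          mul_comm (gaussianPDFReal 0 v x)]
        exact mul_le_mul_of_nonneg_right (abs_pow_mul_gaussianPDFReal_le hv hv2 a x)
          (abs_nonneg _)
    _ ≤ _ := by
        rw [integral_const_mul]
        exact mul_le_mul_of_nonneg_left hcs (by positivity)

lemma abs_gaussianMean_X_pow_mul_hermite_mul_hermite_le (hv : v ≠ 0) (hv2 : v ≤ 1 / 2)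
    (a b c : ℕ) :
    |gaussianMean v
        (Polynomial.X ^ a * (hermite (2 * v : ℝ)⁻¹ b * hermite (2 * v : ℝ)⁻¹ c))| ≤
      √2 * √(a.factorial : ℝ) *
        (√((2 * v : ℝ)⁻¹ ^ b / b.factorial) * √((2 * v : ℝ)⁻¹ ^ c / c.factorial)) := by
  have h := abs_gaussianMean_X_pow_mul_mul_le hv hv2 a (hermite (2 * v : ℝ)⁻¹ b)
    (hermite (2 * v : ℝ)⁻¹ c)
  have hsq (n : ℕ) := gaussianMean_hermite_sq (mul_ne_zero two_ne_zero hv) n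
  push_cast at hsq
  rwa [hsq, hsq] at h

end MomentBound

section MvGaussianMean

open scoped Polynomial

variable {σ : Type*} [Fintype σ] (v : ℝ≥0)

lemma monomial_eq_prod_toMvPolynomial (α : σ →₀ ℕ) :
    monomial α (1 : ℝ) = ∏ j, ((Polynomial.X : ℝ[X]) ^ α j).toMvPolynomial j := by
  rw [monomial_eq, C_1, one_mul, Finsupp.prod_fintype _ _ fun _ => pow_zero _]
  simp

lemma integrable_eval_pi_gaussianReal (f : MvPolynomial σ ℝ) :
    Integrable (fun x => eval x f) (Measure.pi fun _ : σ => gaussianReal 0 v) := by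
  induction f using MvPolynomial.induction_on' with
  | add f g hf hg =>
    simp only [map_add]
    exact hf.add hg
  | monomial α c =>
    have hprod := (Integrable.fintype_prod fun j =>
      integrable_eval_gaussianReal v ((Polynomial.X : ℝ[X]) ^ α j)).const_mul c
    refine hprod.congr (.of_forall fun x => ?_)
    simp [eval_monomial, Finsupp.prod_fintype]

/-- The functional `f ↦ 𝔼 f(Y)` on polynomials, where the coordinates of `Y` are independent
centred Gaussians of variance `v`. -/
def mvGaussianMean : MvPolynomial σ ℝ →ₗ[ℝ] ℝ where
  toFun f := ∫ x, eval x f ∂Measure.pi fun _ => gaussianReal 0 v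
  map_add' f g := by
    simp only [map_add]
    exact integral_add (integrable_eval_pi_gaussianReal v f) (integrable_eval_pi_gaussianReal v g)
  map_smul' c f := by
    simp only [smul_eval]
    exact integral_const_mul c _

lemma mvGaussianMean_mul_eq_sum (p f : MvPolynomial σ ℝ) :
    mvGaussianMean v (p * f) =
      ∑ α ∈ p.support, p.coeff α * mvGaussianMean v (monomial α 1 * f) := by
  nth_rewrite 1 [p.as_sum]
  rw [Finset.sum_mul, map_sum]
  refine Finset.sum_congr rfl fun α _ => ?_
  have hα : monomial α (p.coeff α) = p.coeff α • monomial α (1 : ℝ) := by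
    rw [smul_monomial, smul_eq_mul, mul_one]
  rw [hα, smul_mul_assoc, map_smul, smul_eq_mul]

lemma mvGaussianMean_nonneg {f : MvPolynomial σ ℝ} (hf : ∀ x, 0 ≤ eval x f) :
    0 ≤ mvGaussianMean v f :=
  integral_nonneg hf

lemma mvGaussianMean_prod_toMvPolynomial (f : σ → ℝ[X]) :
    mvGaussianMean v (∏ j, (f j).toMvPolynomial j) = ∏ j, gaussianMean v (f j) := by
  simp only [gaussianMean_apply, ← integral_fintype_prod_eq_prod]
  refine integral_congr_ae (.of_forall fun x => ?_)
  simp [eval_toMvPolynomial]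

end MvGaussianMean

section MvHermite

variable {σ : Type*} [Fintype σ] {v : ℝ≥0}

/-- The product `∏_j H_{β_j}(x_j)` of rescaled Hermite polynomials. -/
def mvHermite (τ : ℝ) (β : σ →₀ ℕ) : MvPolynomial σ ℝ :=
  ∏ j, (hermite τ (β j)).toMvPolynomial j

lemma sum_antidiagonal_mvHermite_mul [DecidableEq σ] (τ : ℝ) (δ : σ →₀ ℕ) :
    ∑ p ∈ antidiagonal δ, mvHermite τ p.1 * mvHermite τ p.2 = mvHermite (2 * τ) δ := by
  have h := sum_antidiagonal_prod (fun j n => (hermite τ n).toMvPolynomial j)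
    (fun j n => (hermite τ n).toMvPolynomial j) δ
  simp only [← map_mul, ← map_sum, sum_antidiagonal_hermite_mul] at h
  exact h

lemma mvGaussianMean_monomial_mul_mvHermite (hv : v ≠ 0) (α δ : σ →₀ ℕ) :
    mvGaussianMean v (monomial α 1 * mvHermite (v : ℝ)⁻¹ δ) =
      ∏ j, gaussianAverageCoeff v (α j) (δ j) := by
  rw [monomial_eq_prod_toMvPolynomial, mvHermite, ← Finset.prod_mul_distrib]
  simp only [← map_mul, mvGaussianMean_prod_toMvPolynomial, gaussianMean_X_pow_mul_hermite hv]

/-- The Gram matrix `𝔼 [p(Y) H_β(Y) H_γ(Y)]` of a polynomial `p`, where the coordinates of `Y` are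
centred Gaussians of variance `v`. The Hermite polynomials are orthogonal for variance `2v`, so that
the Cauchy product of `(H_β)` with itself is the orthogonal family for variance `v`. -/
def gaussianGram (v : ℝ≥0) (p : MvPolynomial σ ℝ) (β γ : σ →₀ ℕ) : ℝ :=
  mvGaussianMean v (p * (mvHermite (2 * v : ℝ)⁻¹ β * mvHermite (2 * v : ℝ)⁻¹ γ))

lemma gaussianGram_comm (v : ℝ≥0) (p : MvPolynomial σ ℝ) (β γ : σ →₀ ℕ) :
    gaussianGram v p β γ = gaussianGram v p γ β := by
  rw [gaussianGram, gaussianGram, mul_comm (mvHermite _ β)]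

lemma gaussianGram_posSemidef (v : ℝ≥0) {p : MvPolynomial σ ℝ} (hp : ∀ x, 0 ≤ eval x p)
    (I : Finset (σ →₀ ℕ)) (u : (σ →₀ ℕ) → ℝ) :
    0 ≤ ∑ β ∈ I, ∑ γ ∈ I, u β * u γ * gaussianGram v p β γ := by
  have hsq : ∑ β ∈ I, ∑ γ ∈ I, u β * u γ * gaussianGram v p β γ =
      mvGaussianMean v (p * (∑ β ∈ I, u β • mvHermite (2 * v : ℝ)⁻¹ β) ^ 2) := by
    rw [sq, Finset.sum_mul_sum, Finset.mul_sum, map_sum]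
    refine Finset.sum_congr rfl fun β _ => ?_
    rw [Finset.mul_sum, map_sum]
    refine Finset.sum_congr rfl fun γ _ => ?_
    rw [smul_mul_smul_comm, mul_smul_comm, map_smul, smul_eq_mul, gaussianGram]
  rw [hsq]
  refine mvGaussianMean_nonneg v fun x => ?_
  rw [map_mul, map_pow]
  exact mul_nonneg (hp x) (sq_nonneg _)

lemma sum_antidiagonal_gaussianGram [DecidableEq σ] (v : ℝ≥0) (p : MvPolynomial σ ℝ)
    (δ : σ →₀ ℕ) :
    ∑ q ∈ antidiagonal δ, gaussianGram v p q.1 q.2 =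
      mvGaussianMean v (p * mvHermite (v : ℝ)⁻¹ δ) := by
  have hτ : (v : ℝ)⁻¹ = 2 * (2 * (v : ℝ))⁻¹ := by
    rw [mul_inv, mul_inv_cancel_left₀ two_ne_zero]
  simp only [gaussianGram, ← map_sum, ← Finset.mul_sum, sum_antidiagonal_mvHermite_mul, hτ]

lemma abs_gaussianGram_monomial_le (hv : v ≠ 0) (hv2 : v ≤ 1 / 2) (α β γ : σ →₀ ℕ) :
    |gaussianGram v (monomial α 1) β γ| ≤ √2 ^ Fintype.card σ * √(multiFactorial α) *
      (√((2 * v : ℝ)⁻¹ ^ β.degree / multiFactorial β) *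
        √((2 * v : ℝ)⁻¹ ^ γ.degree / multiFactorial γ)) := by
  have hsqrt (δ : σ →₀ ℕ) : √((2 * v : ℝ)⁻¹ ^ δ.degree / multiFactorial δ) =
      ∏ j, √((2 * v : ℝ)⁻¹ ^ δ j / (δ j).factorial) := by
    rw [← Real.sqrt_prod _ fun _ _ => by positivity, Finset.prod_div_distrib,
      Finset.prod_pow_eq_pow_sum, Finsupp.degree_eq_sum, multiFactorial]
  rw [gaussianGram, monomial_eq_prod_toMvPolynomial, mvHermite, mvHermite,
    ← Finset.prod_mul_distrib, ← Finset.prod_mul_distrib]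
  simp only [← map_mul, mvGaussianMean_prod_toMvPolynomial]
  rw [Finset.abs_prod, sqrt_multiFactorial, hsqrt, hsqrt, ← Finset.prod_mul_distrib,
    ← Finset.card_univ, ← Finset.prod_const, ← Finset.prod_mul_distrib, ← Finset.prod_mul_distrib]
  exact Finset.prod_le_prod (fun _ _ => abs_nonneg _) fun j _ =>
    abs_gaussianMean_X_pow_mul_hermite_mul_hermite_le hv hv2 _ _ _

theorem abs_gaussianGram_le {d : ℕ} (hv : v ≠ 0) (hv2 : v ≤ 1 / 2) (p : MvPolynomial (Fin d) ℝ)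
    (β γ : Fin d →₀ ℕ) :
    |gaussianGram v p β γ| ≤ √2 ^ d * coeffNorm p *
      (√((2 * v : ℝ)⁻¹ ^ β.degree / multiFactorial β) *
        √((2 * v : ℝ)⁻¹ ^ γ.degree / multiFactorial γ)) := by
  have hexpand : gaussianGram v p β γ =
      ∑ α ∈ p.support, p.coeff α * gaussianGram v (monomial α 1) β γ :=
    mvGaussianMean_mul_eq_sum v p _
  rw [hexpand, coeffNorm, Finset.mul_sum, Finset.sum_mul]
  refine (Finset.abs_sum_le_sum_abs _ _).trans (Finset.sum_le_sum fun α _ => ?_)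
  rw [abs_mul]
  have h := abs_gaussianGram_monomial_le hv hv2 α β γ
  rw [Fintype.card_fin] at h
  calc _ ≤ |p.coeff α| * _ := mul_le_mul_of_nonneg_left h (abs_nonneg _)
    _ = _ := by rw [multiFactorial]; ring

end MvHermite

section GaussianAverage

variable {σ : Type*} [Fintype σ] {d : ℕ} {v : ℝ≥0}

/-- The part of degree at most `N` of the polynomial `x ↦ 𝔼 p(x + Y)`, where the coordinates of `Y`
are independent centred Gaussians of variance `v`. -/
def gaussianAverage (v : ℝ≥0) (N : ℕ) (p : MvPolynomial σ ℝ) : MvPolynomial σ ℝ :=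
  ∑ δ ∈ multiIndices σ N, mvGaussianMean v (p * mvHermite (v : ℝ)⁻¹ δ) • monomial δ 1

lemma totalDegree_gaussianAverage_le (v : ℝ≥0) (N : ℕ) (p : MvPolynomial σ ℝ) :
    (gaussianAverage v N p).totalDegree ≤ N :=
  totalDegree_finsetSum_le fun _ hδ => (totalDegree_smul_le _ _).trans <|
    (totalDegree_monomial_le _ _).trans (mem_multiIndices.mp hδ)

lemma gaussianAverage_eq_sum_smul (v : ℝ≥0) (N : ℕ) (p : MvPolynomial σ ℝ) :
    gaussianAverage v N p = ∑ α ∈ p.support, p.coeff α • gaussianAverage v N (monomial α 1) := by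
  simp only [gaussianAverage, Finset.smul_sum, smul_smul]
  rw [Finset.sum_comm]
  refine Finset.sum_congr rfl fun δ _ => ?_
  rw [← Finset.sum_smul, mvGaussianMean_mul_eq_sum]

lemma coeffNorm_monomial_sub_gaussianAverage_le (hv : v ≠ 0) {N : ℕ} {α : Fin d →₀ ℕ}
    (hα : α.degree ≤ N) :
    coeffNorm (monomial α 1 - gaussianAverage v N (monomial α 1)) ≤
      ((1 + v) ^ α.degree - 1) * √(multiFactorial α) := by
  classical
  set K : (Fin d →₀ ℕ) → ℝ := fun δ => ∏ j, gaussianAverageCoeff v (α j) (δ j)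
  have hK (δ) : 0 ≤ K δ := Finset.prod_nonneg fun _ _ => gaussianAverageCoeff_nonneg hv _ _
  have hKα : K α = 1 := Finset.prod_eq_one fun _ _ => gaussianAverageCoeff_self v _
  have hmem : α ∈ multiIndices (Fin d) N := mem_multiIndices.mpr hα
  have hdiff : monomial α 1 - gaussianAverage v N (monomial α 1) =
      ∑ δ ∈ (multiIndices (Fin d) N).erase α, (-K δ) • monomial δ (1 : ℝ) := by
    have hcoeff (δ) : mvGaussianMean v (monomial α 1 * mvHermite (v : ℝ)⁻¹ δ) = K δ :=
      mvGaussianMean_monomial_mul_mvHermite hv α δ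
    simp only [gaussianAverage, hcoeff, neg_smul, Finset.sum_neg_distrib]
    rw [← Finset.add_sum_erase _ _ hmem, hKα, one_smul, sub_add_cancel_left]
  have hmonomial (δ : Fin d →₀ ℕ) : coeffNorm (monomial δ (1 : ℝ)) = √(multiFactorial δ) := by
    rw [coeffNorm_eq_sum support_monomial_subset, Finset.sum_singleton, coeff_monomial, if_pos rfl,
      abs_one, one_mul]
  have hsum : ∑ δ ∈ multiIndices (Fin d) N, K δ * √(multiFactorial δ) ≤
      (1 + v) ^ α.degree * √(multiFactorial α) := by
    simp only [K, sqrt_multiFactorial, ← Finset.prod_mul_distrib]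
    rw [Finsupp.degree_eq_sum, ← Finset.prod_pow_eq_pow_sum, ← Finset.prod_mul_distrib]
    refine (sum_multiIndices_prod_le N fun j n => mul_nonneg
      (gaussianAverageCoeff_nonneg hv (α j) n) (Real.sqrt_nonneg (n.factorial : ℝ))).trans ?_
    exact Finset.prod_le_prod (fun j _ => Finset.sum_nonneg fun n _ => mul_nonneg
      (gaussianAverageCoeff_nonneg hv (α j) n) (Real.sqrt_nonneg _)) fun j _ =>
        sum_gaussianAverageCoeff_le hv _ _
  calc _ ≤ ∑ δ ∈ (multiIndices (Fin d) N).erase α, K δ * √(multiFactorial δ) := by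
        rw [hdiff]
        refine (coeffNorm_sum_smul_le _ _ _).trans_eq (Finset.sum_congr rfl fun δ _ => ?_)
        rw [abs_neg, abs_of_nonneg (hK δ), hmonomial]
    _ = ∑ δ ∈ multiIndices (Fin d) N, K δ * √(multiFactorial δ) - √(multiFactorial α) := by
        rw [Finset.sum_erase_eq_sub hmem, hKα, one_mul]
    _ ≤ _ := by linarith

theorem coeffNorm_sub_gaussianAverage_le (hv : v ≠ 0) {N : ℕ} {p : MvPolynomial (Fin d) ℝ}
    (hpN : p.totalDegree ≤ N) :
    coeffNorm (p - gaussianAverage v N p) ≤ ((1 + v) ^ p.totalDegree - 1) * coeffNorm p := by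
  have hexpand : p - gaussianAverage v N p =
      ∑ α ∈ p.support, p.coeff α • (monomial α 1 - gaussianAverage v N (monomial α 1)) := by
    rw [gaussianAverage_eq_sum_smul]
    nth_rewrite 1 [p.as_sum]
    simp only [smul_sub, Finset.sum_sub_distrib, smul_monomial, smul_eq_mul, mul_one]
  rw [hexpand]
  refine (coeffNorm_sum_smul_le _ _ _).trans ?_
  rw [coeffNorm, Finset.mul_sum]
  refine Finset.sum_le_sum fun α hα => ?_
  rw [mul_left_comm]
  have hdeg := le_totalDegree hα
  refine mul_le_mul_of_nonneg_left
    ((coeffNorm_monomial_sub_gaussianAverage_le hv (hdeg.trans hpN)).trans ?_) (abs_nonneg _)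
  refine mul_le_mul_of_nonneg_right ?_ (Real.sqrt_nonneg _)
  gcongr
  · simp
  · exact hdeg

lemma sum_multiIndices_antidiagonal [DecidableEq σ] {M : Type*} [AddCommMonoid M] (N : ℕ)
    (f : (σ →₀ ℕ) → (σ →₀ ℕ) → M) :
    ∑ δ ∈ multiIndices σ N, ∑ q ∈ antidiagonal δ, f q.1 q.2 =
      ∑ β ∈ multiIndices σ N, ∑ γ ∈ multiIndices σ N,
        if β.degree + γ.degree ≤ N then f β γ else 0 := by
  have hmaps : ∀ q ∈ (multiIndices σ N ×ˢ multiIndices σ N).filter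
      fun q => q.1.degree + q.2.degree ≤ N, q.1 + q.2 ∈ multiIndices σ N := fun q hq => by
    rw [mem_multiIndices, map_add]
    exact (Finset.mem_filter.mp hq).2
  rw [← Finset.sum_product', ← Finset.sum_filter, ← Finset.sum_fiberwise_of_maps_to hmaps]
  refine Finset.sum_congr rfl fun δ hδ => Finset.sum_congr ?_ fun _ _ => rfl
  ext q
  rw [mem_multiIndices] at hδ
  simp only [mem_antidiagonal, Finset.mem_filter, Finset.mem_product, mem_multiIndices]
  refine ⟨?_, And.right⟩
  rintro rfl
  rw [map_add] at hδ
  exact ⟨⟨⟨by omega, by omega⟩, hδ⟩, rfl⟩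

/-- The entries of the Gram matrix of index `|β| + |γ| > N`, which do not contribute to
`gaussianAverage v N p`. -/
def gaussianGramTail (v : ℝ≥0) (N : ℕ) (p : MvPolynomial σ ℝ) (β γ : σ →₀ ℕ) : ℝ :=
  if β.degree + γ.degree ≤ N then 0 else gaussianGram v p β γ

lemma sum_gaussianGram_smul (v : ℝ≥0) (N : ℕ) (p : MvPolynomial σ ℝ) :
    ∑ β ∈ multiIndices σ N, ∑ γ ∈ multiIndices σ N,
        gaussianGram v p β γ • (monomial β (1 : ℝ) * monomial γ 1) =
      gaussianAverage v N p + ∑ β ∈ multiIndices σ N, ∑ γ ∈ multiIndices σ N,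
        gaussianGramTail v N p β γ • (monomial β (1 : ℝ) * monomial γ 1) := by
  classical
  have haverage : gaussianAverage v N p = ∑ δ ∈ multiIndices σ N, ∑ q ∈ antidiagonal δ,
      gaussianGram v p q.1 q.2 • (monomial q.1 (1 : ℝ) * monomial q.2 1) := by
    refine Finset.sum_congr rfl fun δ _ => ?_
    rw [← sum_antidiagonal_gaussianGram, Finset.sum_smul]
    refine Finset.sum_congr rfl fun q hq => ?_
    rw [monomial_mul, one_mul, mem_antidiagonal.mp hq]
  rw [haverage, sum_multiIndices_antidiagonal N fun β γ =>
    gaussianGram v p β γ • (monomial β (1 : ℝ) * monomial γ 1)]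
  simp only [← Finset.sum_add_distrib]
  refine Finset.sum_congr rfl fun β _ => Finset.sum_congr rfl fun γ _ => ?_
  rw [gaussianGramTail]
  split_ifs <;> simp

end GaussianAverage

section TruncationOrder

lemma two_mul_pow_le_factorial {R : ℝ} (hR : 0 ≤ R) {n : ℕ} (hn : 2 * Real.exp 1 * R ≤ n) :
    (2 * R) ^ n ≤ n.factorial := by
  have hexp := Real.pow_div_factorial_le_exp (n : ℝ) n.cast_nonneg n
  rw [div_le_iff₀ (by positivity)] at hexp
  refine le_of_mul_le_mul_right ?_ (Real.exp_pos n)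
  calc (2 * R) ^ n * Real.exp n = (2 * Real.exp 1 * R) ^ n := by
        rw [← mul_one (n : ℝ), Real.exp_nat_mul, ← mul_pow, mul_right_comm]
    _ ≤ (n : ℝ) ^ n := by gcongr
    _ ≤ n.factorial * Real.exp n := by rwa [mul_comm]

lemma pow_add_le_factorial_mul_factorial_rpow {r s : ℝ} (hr : 0 ≤ r) (hs : 0 < s) {b c : ℕ}
    (h : 2 * Real.exp 1 * r ^ (1 / s) ≤ (b + c : ℕ)) :
    r ^ (b + c) ≤ ((b.factorial : ℝ) * c.factorial) ^ s := by
  have hR : 0 ≤ r ^ (1 / s) := Real.rpow_nonneg hr _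
  have hfactorial : ((b + c).factorial : ℝ) ≤ 2 ^ (b + c) * (b.factorial * c.factorial) := by
    rw [← Nat.add_choose_mul_factorial_mul_factorial b c, mul_assoc]
    push_cast
    gcongr
    exact_mod_cast Nat.choose_le_two_pow (b + c) c
  have hpow : (r ^ (1 / s)) ^ (b + c) ≤ b.factorial * c.factorial := by
    refine le_of_mul_le_mul_left ?_ (show (0 : ℝ) < 2 ^ (b + c) by positivity)
    rw [← mul_pow]
    exact (two_mul_pow_le_factorial hR h).trans hfactorial
  calc r ^ (b + c) = ((r ^ (1 / s)) ^ (b + c)) ^ s := by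
        rw [← Real.rpow_natCast, ← Real.rpow_natCast, ← Real.rpow_mul hr, ← Real.rpow_mul hr,
          mul_right_comm,
          one_div_mul_cancel hs.ne', one_mul]
    _ ≤ _ := by gcongr

lemma sqrt_div_mul_sqrt_div_le_weight {d : ℕ} {τ t : ℝ} (hτ : 0 ≤ τ) (ht : t < 1)
    {β γ : Fin d →₀ ℕ}
    (h : 2 * Real.exp 1 * (2 * τ) ^ (1 / (1 - t)) ≤ (β.degree + γ.degree : ℕ)) :
    √(τ ^ β.degree / multiFactorial β) * √(τ ^ γ.degree / multiFactorial γ) ≤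
      √(1 / 2) ^ (β.degree + γ.degree) * (√(weight t β) * √(weight t γ)) := by
  have hβ := multiFactorial_pos β
  have hγ := multiFactorial_pos γ
  have hfactorial : (2 * τ) ^ (β.degree + γ.degree) ≤
      (β.degree.factorial : ℝ) ^ (1 - t) * (γ.degree.factorial : ℝ) ^ (1 - t) := by
    rw [← Real.mul_rpow (by positivity) (by positivity)]
    exact pow_add_le_factorial_mul_factorial_rpow (by positivity) (sub_pos.mpr ht) h
  have hw := weight_pos t β
  have hw' := weight_pos t γ
  rw [← Real.sqrt_mul (by positivity), ← Real.sqrt_mul hw.le]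
  refine Real.sqrt_le_iff.mpr ⟨by positivity, ?_⟩
  rw [mul_pow, Real.sq_sqrt (by positivity), pow_right_comm, Real.sq_sqrt (by norm_num)]
  calc τ ^ β.degree / multiFactorial β * (τ ^ γ.degree / multiFactorial γ) =
        (1 / 2) ^ (β.degree + γ.degree) *
          ((2 * τ) ^ (β.degree + γ.degree) / (multiFactorial β * multiFactorial γ)) := by
        rw [mul_pow, one_div, inv_pow, pow_add τ]
        field_simp
    _ ≤ (1 / 2) ^ (β.degree + γ.degree) *
          ((β.degree.factorial : ℝ) ^ (1 - t) * (γ.degree.factorial : ℝ) ^ (1 - t) /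
            (multiFactorial β * multiFactorial γ)) := by gcongr
    _ = _ := by rw [weight, weight, div_mul_div_comm]

lemma mul_pow_mul_pow_le_of_ten_mul_add_le {x : ℝ} (hx : 0 ≤ x) {d N : ℕ}
    (hN : 10 * (d + x) ≤ N) : √2 ^ d * x * √(2 / 3) ^ N * 4 ^ d ≤ 1 / 4 := by
  have he : 2.7 ≤ Real.exp 1 := by linarith [Real.exp_one_gt_d9]
  have hexp_two : Real.exp 2 = Real.exp 1 ^ 2 := by rw [← Real.exp_nat_mul]; norm_num
  have hbase : √(2 / 3) ≤ Real.exp (-(1 / 5)) := by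
    refine Real.sqrt_le_iff.mpr ⟨(Real.exp_pos _).le, ?_⟩
    refine le_of_pow_le_pow_left₀ (show 5 ≠ 0 by norm_num) (by positivity) ?_
    calc (2 / 3 : ℝ) ^ 5 ≤ (2.72 ^ 2)⁻¹ := by norm_num
      _ ≤ (Real.exp 1 ^ 2)⁻¹ := by
        gcongr
        linarith [Real.exp_one_lt_d9]
      _ = (Real.exp (-(1 / 5)) ^ 2) ^ 5 := by
        rw [← hexp_two, ← pow_mul, ← Real.exp_neg, ← Real.exp_nat_mul]
        norm_num
  have hdim : √2 * 4 ≤ Real.exp 2 := by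
    have hsqrt : √2 ≤ 3 / 2 := Real.sqrt_le_iff.mpr (by norm_num)
    rw [hexp_two]
    nlinarith
  have hnorm : 4 * x ≤ Real.exp (2 * x) := by
    nlinarith [Real.exp_one_mul_le_exp (x := 2 * x)]
  have hpow : √(2 / 3) ^ N ≤ (Real.exp 2 ^ d * Real.exp (2 * x))⁻¹ := by
    rw [← Real.exp_nat_mul, ← Real.exp_add, ← Real.exp_neg]
    refine (pow_le_pow_left₀ (Real.sqrt_nonneg _) hbase N).trans ?_
    rw [← Real.exp_nat_mul, Real.exp_le_exp]
    linarith
  calc √2 ^ d * x * √(2 / 3) ^ N * 4 ^ d =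
        (√2 * 4) ^ d * (4 * x) * √(2 / 3) ^ N / 4 := by rw [mul_pow]; ring
    _ ≤ Real.exp 2 ^ d * Real.exp (2 * x) * (Real.exp 2 ^ d * Real.exp (2 * x))⁻¹ / 4 := by
        gcongr
    _ = 1 / 4 := by rw [mul_inv_cancel₀ (by positivity)]

lemma one_add_inv_pow_sub_one_mul_le {x κ : ℝ} (hx : 1 ≤ x) (hκ : 0 < κ) {D : ℕ}
    (hD : D ≤ 2 * κ) : ((1 + (4 * κ * x)⁻¹) ^ D - 1) * x ≤ 3 / 4 := by
  set y : ℝ := (2 * x)⁻¹ with hy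
  have hxy : x * y = 1 / 2 := by rw [hy]; field_simp
  have hy0 : 0 ≤ y := by positivity
  have hy1 : y ≤ 1 / 2 := by nlinarith
  have hpow : (1 + (4 * κ * x)⁻¹) ^ D ≤ Real.exp y := by
    calc _ ≤ Real.exp ((4 * κ * x)⁻¹) ^ D := by
          gcongr
          linarith [Real.add_one_le_exp (4 * κ * x)⁻¹]
      _ = Real.exp (D * (4 * κ * x)⁻¹) := (Real.exp_nat_mul _ _).symm
      _ ≤ Real.exp (2 * κ * (4 * κ * x)⁻¹) := by gcongr
      _ = Real.exp y := by
          congr 1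
          rw [hy]
          field_simp
          norm_num
  have hexp : Real.exp y ≤ 1 + y + y ^ 2 := by
    have := Real.abs_exp_sub_one_sub_id_le (x := y) (by rw [abs_of_nonneg hy0]; linarith)
    linarith [le_abs_self (Real.exp y - 1 - y)]
  calc ((1 + (4 * κ * x)⁻¹) ^ D - 1) * x ≤ (y + y ^ 2) * x := by gcongr; linarith
    _ = x * y + x * y * y := by ring
    _ ≤ 3 / 4 := by rw [hxy]; linarith

lemma sum_multiIndices_three_quarters_pow_le (d N : ℕ) :
    ∑ β ∈ multiIndices (Fin d) N, (3 / 4 : ℝ) ^ β.degree ≤ 4 ^ d := by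
  calc ∑ β ∈ multiIndices (Fin d) N, (3 / 4 : ℝ) ^ β.degree =
        ∑ β ∈ multiIndices (Fin d) N, ∏ j, (3 / 4 : ℝ) ^ β j := by
        simp only [Finset.prod_pow_eq_pow_sum, Finsupp.degree_eq_sum]
    _ ≤ ∏ _j : Fin d, ∑ n ∈ Finset.range (N + 1), (3 / 4 : ℝ) ^ n :=
        sum_multiIndices_prod_le N (f := fun _ n => (3 / 4 : ℝ) ^ n) fun _ _ => by positivity
    _ ≤ ∏ _j : Fin d, (4 : ℝ) := by
        refine Finset.prod_le_prod (fun _ _ => by positivity) fun _ _ => ?_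
        refine (Summable.sum_le_tsum _ (fun _ _ => by positivity)
          (summable_geometric_of_lt_one (by norm_num) (by norm_num))).trans_eq ?_
        rw [tsum_geometric_of_lt_one (by norm_num) (by norm_num)]
        norm_num
    _ = 4 ^ d := by simp

end TruncationOrder

section ExplicitConstants

variable {d M : ℕ}

lemma two_mul_sqrt_two_le_two_rpow (hM : 1 ≤ M) : 2 * √2 ≤ (2 : ℝ) ^ ((M : ℝ) + 1 / 2) := by
  rw [Real.rpow_add two_pos, Real.rpow_natCast, ← Real.sqrt_eq_rpow]
  gcongr
  exact le_self_pow₀ one_le_two (by omega)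

lemma two_mul_le_mu (hM : 1 ≤ M) : 2 * (M : ℝ) ≤ mu d M := by
  have hchoose : 1 ≤ √((2 * M + d - 1).choose (d - 1) : ℝ) := by
    rw [Real.one_le_sqrt]
    exact_mod_cast Nat.choose_pos (by omega)
  have hpow := two_mul_sqrt_two_le_two_rpow hM
  have hsqrt : 1 ≤ √2 := by rw [Real.one_le_sqrt]; norm_num
  calc 2 * (M : ℝ) = M * 1 * 2 := by ring
    _ ≤ mu d M := by
      rw [mu]
      gcongr
      linarith

lemma mul_self_le_two_mul_choose (hd : 1 ≤ d) (hM : 1 ≤ M) :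
    d * d ≤ 2 * (2 * M + d - 1).choose (d - 1) := by
  have hmono : (d + 1).choose (d - 1) ≤ (2 * M + d - 1).choose (d - 1) :=
    Nat.choose_le_choose _ (by omega)
  have hsymm : (d + 1).choose (d - 1) = (d + 1).choose 2 :=
    Nat.choose_symm_of_eq_add (by omega)
  have htwo := Nat.add_one_mul_choose_eq d 1
  rw [Nat.choose_one_right] at htwo
  nlinarith

lemma two_mul_card_le_mu (hd : 1 ≤ d) (hM : 1 ≤ M) : 2 * (d : ℝ) ≤ mu d M := by
  have hchoose : (d : ℝ) / √2 ≤ √((2 * M + d - 1).choose (d - 1) : ℝ) := by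
    refine Real.le_sqrt_of_sq_le ?_
    rw [div_pow, Real.sq_sqrt zero_le_two, div_le_iff₀ two_pos, sq, mul_comm _ (2 : ℝ)]
    exact_mod_cast mul_self_le_two_mul_choose hd hM
  have hpow := two_mul_sqrt_two_le_two_rpow hM
  have hM' : (1 : ℝ) ≤ M := by exact_mod_cast hM
  calc 2 * (d : ℝ) = 1 * (d / √2) * (2 * √2) := by field_simp
    _ ≤ mu d M := by
      rw [mu]
      gcongr

lemma two_mul_le_Nexpl (M : ℕ) (t : ℝ) (q : MvPolynomial (Fin d) ℝ) : 2 * M ≤ Nexpl M t q := by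
  have hceil : 0 ≤ ⌈5 * (d : ℝ) / 2⌉ := Int.ceil_nonneg (by positivity)
  rw [Nexpl]
  zify
  refine le_trans ?_ ((le_max_left _ _).trans (Int.self_le_toNat _))
  linarith

lemma two_exp_mul_rpow_le_Nexpl (M : ℕ) (t : ℝ) (q : MvPolynomial (Fin d) ℝ) :
    2 * Real.exp 1 * (4 * mu d M * coeffNorm q) ^ (1 / (1 - t)) ≤ Nexpl M t q := by
  have hfloor : 0 ≤ ⌊3 * (d : ℝ) / 2⌋ := Int.floor_nonneg.mpr (by positivity)
  have hmax := le_max_left (0 : ℤ) ⌈1 / (1 - t) *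
    Real.log (((d : ℝ) + 1) ^ 2 * 2 ^ (2 * d) * coeffNorm q / mu d M)⌉
  refine (Int.le_ceil _).trans ?_
  rw [Nexpl, ← Int.cast_natCast]
  refine Int.cast_le.mpr (le_trans ?_ ((le_max_right _ _).trans (Int.self_le_toNat _)))
  linarith

end ExplicitConstants

section PerturbedPolynomial

variable {d N : ℕ} {v : ℝ≥0} {t : ℝ} {p : MvPolynomial (Fin d) ℝ}

lemma abs_gaussianGramTail_le (hv : v ≠ 0) (hv2 : v ≤ 1 / 2) (ht : t < 1)
    (hN : 2 * Real.exp 1 * (v : ℝ)⁻¹ ^ (1 / (1 - t)) ≤ N) (p : MvPolynomial (Fin d) ℝ)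
    (β γ : Fin d →₀ ℕ) :
    |gaussianGramTail v N p β γ| ≤ √2 ^ d * coeffNorm p * √(2 / 3) ^ N *
      (√(3 / 4) ^ β.degree * √(3 / 4) ^ γ.degree) * (√(weight t β) * √(weight t γ)) := by
  have hp := coeffNorm_nonneg p
  rw [gaussianGramTail]
  split_ifs with hdeg
  · rw [abs_zero]
    positivity
  have hdecay : √(1 / 2) ^ (β.degree + γ.degree) ≤
      √(2 / 3) ^ N * (√(3 / 4) ^ β.degree * √(3 / 4) ^ γ.degree) := by
    have hbase : √(1 / 2) = √(2 / 3) * √(3 / 4) := by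
      rw [← Real.sqrt_mul (by norm_num)]
      norm_num
    rw [hbase, mul_pow, ← pow_add]
    gcongr ?_ * _
    exact pow_le_pow_of_le_one (Real.sqrt_nonneg _) (Real.sqrt_le_one.mpr (by norm_num))
      (not_le.mp hdeg).le
  have hweight : √((2 * v : ℝ)⁻¹ ^ β.degree / multiFactorial β) *
      √((2 * v : ℝ)⁻¹ ^ γ.degree / multiFactorial γ) ≤
        √(1 / 2) ^ (β.degree + γ.degree) * (√(weight t β) * √(weight t γ)) := by
    refine sqrt_div_mul_sqrt_div_le_weight (by positivity) ht ?_
    rw [mul_inv, mul_inv_cancel_left₀ two_ne_zero]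
    exact hN.trans (Nat.cast_le.mpr (not_le.mp hdeg).le)
  calc |gaussianGram v p β γ| ≤ _ := abs_gaussianGram_le hv hv2 p β γ
    _ ≤ √2 ^ d * coeffNorm p * (√(1 / 2) ^ (β.degree + γ.degree) *
          (√(weight t β) * √(weight t γ))) := by gcongr
    _ ≤ √2 ^ d * coeffNorm p * (√(2 / 3) ^ N * (√(3 / 4) ^ β.degree * √(3 / 4) ^ γ.degree) *
          (√(weight t β) * √(weight t γ))) := by gcongr
    _ = _ := by ring

lemma isSumSq_smul_perturbation_sub_sum_gaussianGramTail (hv : v ≠ 0) (hv2 : v ≤ 1 / 2)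
    (ht : t < 1) (hN : 2 * Real.exp 1 * (v : ℝ)⁻¹ ^ (1 / (1 - t)) ≤ N) {K : ℝ}
    (hK : √2 ^ d * coeffNorm p * √(2 / 3) ^ N * 4 ^ d ≤ K) :
    IsSumSq (K • perturbation d t N - ∑ β ∈ multiIndices (Fin d) N,
      ∑ γ ∈ multiIndices (Fin d) N,
        gaussianGramTail v N p β γ • (monomial β (1 : ℝ) * monomial γ 1)) := by
  set A := √2 ^ d * coeffNorm p * √(2 / 3) ^ N
  have hA : 0 ≤ A := by have := coeffNorm_nonneg p; positivity
  set s : (Fin d →₀ ℕ) → ℝ := fun β => √A * √(3 / 4) ^ β.degree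
  have hs : ∑ β ∈ multiIndices (Fin d) N, s β ^ 2 ≤ K := by
    simp only [s, mul_pow, Real.sq_sqrt hA, pow_right_comm _ _ 2]
    rw [← Finset.mul_sum, Real.sq_sqrt (by norm_num)]
    exact (mul_le_mul_of_nonneg_left (sum_multiIndices_three_quarters_pow_le d N) hA).trans hK
  have hsymm (β γ) : -gaussianGramTail v N p β γ = -gaussianGramTail v N p γ β := by
    rw [gaussianGramTail, gaussianGramTail, gaussianGram_comm, add_comm]
  have hbound (β γ) : |-gaussianGramTail v N p β γ| ≤
      s β * s γ * (√(weight t β) * √(weight t γ)) := by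
    have hss : s β * s γ = A * (√(3 / 4) ^ β.degree * √(3 / 4) ^ γ.degree) := by
      rw [mul_mul_mul_comm, Real.mul_self_sqrt hA]
    rw [abs_neg, hss]
    exact abs_gaussianGramTail_le hv hv2 ht hN p β γ
  have htail := isSumSq_sum_smul_add_sum_smul_sq (I := multiIndices (Fin d) N)
    (w := weight t) hsymm (fun β _ => (weight_pos t β).le) (fun β _ γ _ => hbound β γ)
    fun β => monomial β (1 : ℝ)
  rw [← perturbation_eq_sum_weight] at htail
  simp only [neg_smul, Finset.sum_neg_distrib] at htail
  have hsplit (f : MvPolynomial (Fin d) ℝ) : K • perturbation d t N - f =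
      (-f + (∑ β ∈ multiIndices (Fin d) N, s β ^ 2) • perturbation d t N) +
        (K - ∑ β ∈ multiIndices (Fin d) N, s β ^ 2) • perturbation d t N := by module
  exact hsplit _ ▸ htail.add (isSumSq_smul (sub_nonneg.mpr hs) (isSumSq_perturbation t N))

theorem isSumSq_add_perturbation_of_gaussian (hv : v ≠ 0) (hv2 : v ≤ 1 / 2) (ht : t < 1)
    (hp : ∀ ξ, 0 ≤ eval ξ p) (hpN : p.totalDegree ≤ N)
    (hN : 2 * Real.exp 1 * (v : ℝ)⁻¹ ^ (1 / (1 - t)) ≤ N)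
    (haverage : ((1 + v) ^ p.totalDegree - 1) * coeffNorm p ≤ 3 / 4)
    (htail : √2 ^ d * coeffNorm p * √(2 / 3) ^ N * 4 ^ d ≤ 1 / 4) :
    IsSumSq (p + perturbation d t N) := by
  have hgram := isSumSq_sum_smul_of_posSemidef (gaussianGram_comm v p)
    (gaussianGram_posSemidef v hp (multiIndices (Fin d) N)) fun β => monomial β (1 : ℝ)
  have hdegree : (p - gaussianAverage v N p).totalDegree ≤ N :=
    (totalDegree_sub _ _).trans (max_le hpN (totalDegree_gaussianAverage_le v N p))
  have hdiff := isSumSq_add_smul_perturbation_one hdegree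
    ((coeffNorm_sub_gaussianAverage_le hv hpN).trans haverage)
  have hgramTail := isSumSq_smul_perturbation_sub_sum_gaussianGramTail hv hv2 ht hN htail
  have hmono := isSumSq_smul (show (0 : ℝ) ≤ 3 / 4 by norm_num)
    (isSumSq_perturbation_sub (d := d) ht.le N)
  rw [sum_gaussianGram_smul] at hgram
  have hsplit (a f q r : MvPolynomial (Fin d) ℝ) : p + q =
      (a + f) + (p - a + (3 / 4 : ℝ) • r) + ((1 / 4 : ℝ) • q - f) + (3 / 4 : ℝ) • (q - r) := by
    module
  exact hsplit _ _ _ _ ▸ ((hgram.add hdiff).add hgramTail).add hmono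

theorem isSumSq_add_perturbation {κ : ℝ} (ht0 : 0 ≤ t) (ht1 : t < 1) (hp : ∀ ξ, 0 ≤ eval ξ p)
    (hκ : 1 ≤ κ) (hdκ : d ≤ κ) (hpκ : p.totalDegree ≤ 2 * κ) (hpN : p.totalDegree ≤ N)
    (hN : 2 * Real.exp 1 * (4 * κ * coeffNorm p) ^ (1 / (1 - t)) ≤ N) :
    IsSumSq (p + perturbation d t N) := by
  obtain hx | hx := le_total (coeffNorm p) 1
  · have hsplit : p + perturbation d t N =
        p + (1 : ℝ) • perturbation d 1 N + (perturbation d t N - perturbation d 1 N) := by module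
    exact hsplit ▸ (isSumSq_add_smul_perturbation_one hpN hx).add
      (isSumSq_perturbation_sub ht1.le N)
  set x := coeffNorm p
  have hκx : 4 ≤ 4 * κ * x := by nlinarith
  have hd : 10 * (d + x) ≤ N := by
    have hrpow : 4 * κ * x ≤ (4 * κ * x) ^ (1 / (1 - t)) := by
      refine Real.self_le_rpow_of_one_le (by linarith) ?_
      rw [one_le_div (by linarith)]
      linarith
    have he : 5 ≤ 2 * Real.exp 1 := by linarith [Real.exp_one_gt_d9]
    calc 10 * (d + x) ≤ 5 * (4 * κ * x) := by nlinarith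
      _ ≤ 2 * Real.exp 1 * (4 * κ * x) ^ (1 / (1 - t)) := by gcongr
      _ ≤ N := hN
  let v : ℝ≥0 := ⟨(4 * κ * x)⁻¹, by positivity⟩
  have hv_inv : (v : ℝ)⁻¹ = 4 * κ * x := inv_inv _
  have hv : v ≠ 0 := by
    rw [← NNReal.coe_ne_zero]
    exact inv_ne_zero (by positivity)
  have hv2 : v ≤ 1 / 2 := by
    rw [← NNReal.coe_le_coe, one_div]
    exact inv_anti₀ two_pos (by norm_num; linarith)
  exact isSumSq_add_perturbation_of_gaussian hv hv2 ht1 hp hpN (by rwa [hv_inv])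
    (one_add_inv_pow_sub_one_mul_le hx (by linarith) hpκ)
    (mul_pow_mul_pow_le_of_ten_mul_add_le (by linarith) hd)

end PerturbedPolynomial

end

end SOSPerturbation

open MvPolynomial SOSPerturbation in
theorem theorem2_general {d N : ℕ} {p : MvPolynomial (Fin d) ℝ} {t ε κ : ℝ} (ht0 : 0 ≤ t)
    (ht1 : t < 1) (hε : 0 < ε) (hp : ∀ ξ, 0 ≤ eval ξ p) (hκ : 1 ≤ κ) (hdκ : d ≤ κ)
    (hpκ : p.totalDegree ≤ 2 * κ) (hpN : p.totalDegree ≤ N)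
    (hN : 2 * Real.exp 1 * (4 * κ * coeffNorm (C ε⁻¹ * p)) ^ (1 / (1 - t)) ≤ N) :
    IsSumSq (p + C ε * perturbation d t N) := by
  have hdeg : (C ε⁻¹ * p).totalDegree ≤ p.totalDegree :=
    (totalDegree_mul _ _).trans (by rw [totalDegree_C, zero_add])
  have hnonneg (ξ) : 0 ≤ eval ξ (C ε⁻¹ * p) := by
    rw [map_mul, eval_C]
    exact mul_nonneg (inv_pos.mpr hε).le (hp ξ)
  have h := isSumSq_smul hε.le <| isSumSq_add_perturbation ht0 ht1 hnonneg hκ hdκ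
    ((Nat.cast_le.mpr hdeg).trans hpκ) (hdeg.trans hpN) hN
  rwa [smul_add, smul_eq_C_mul, ← mul_assoc, ← C_mul, mul_inv_cancel₀ hε.ne', C_1, one_mul,
    smul_eq_C_mul] at h

theorem theorem2 (d M : ℕ) (hd : 1 ≤ d) (hM : 1 ≤ M)
    (p : MvPolynomial (Fin d) ℝ) (hdeg : p.totalDegree ≤ 2 * M)
    (t : ℝ) (ht0 : 0 ≤ t) (ht1 : t < 1) (ε : ℝ) (hε : 0 < ε)
    (hp : ∀ ξ : Fin d → ℝ, 0 ≤ MvPolynomial.eval ξ p) :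
    IsSumSq
      (p + MvPolynomial.C ε *
        SOSPerturbation.perturbation d t
          (SOSPerturbation.Nexpl M t (MvPolynomial.C ε⁻¹ * p))) := by
  have hμM : 2 * (M : ℝ) ≤ SOSPerturbation.mu d M := SOSPerturbation.two_mul_le_mu hM
  have hμd : 2 * (d : ℝ) ≤ SOSPerturbation.mu d M := SOSPerturbation.two_mul_card_le_mu hd hM
  have hM' : (1 : ℝ) ≤ M := Nat.one_le_cast.mpr hM
  have hdeg' : (p.totalDegree : ℝ) ≤ 2 * M := by exact_mod_cast hdeg
  exact theorem2_general ht0 ht1 hε hp (by linarith) (by linarith) (by linarith)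
    (hdeg.trans (SOSPerturbation.two_mul_le_Nexpl M t _))
    (SOSPerturbation.two_exp_mul_rpow_le_Nexpl M t _)
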